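/- Conventions. Let $X$ be a nonempty set and $\mathcal{C}$ a family of subsets of $X$; its nonempty members are called regions. $(X,\mathcal{C})$ is a category base if $X=\bigcup\mathcal{C}$ and, for every region $A$ and every nonempty family $\mathcal{D}$ of mutually disjoint regions with $\mathrm{card}(\mathcal{D})<\mathrm{card}(\mathcal{C})$: (i) if $A\cap\bigcup\mathcal{D}$ contains a region, then $A\cap D$ contains a region for some $D\in\mathcal{D}$; (ii) if $A\cap\bigcup\mathcal{D}$ contains no region, then some region $B\subseteq A$ is disjoint from every member of $\mathcal{D}$. In a category base, a set is singular if every region contains a subregion disjoint from it; meager if it is a countable union of singular sets, and abundant otherwise; abundant everywhere if its intersection with every region is abundant; a Baire set if every region contains a subregion $B$ such that the part of $B$ inside the set or the part of $B$ outside it is meager; rare if it is uncountable and meets every meager set in a countable set. The base satisfies c.c.c. if every family of mutually disjoint regions is countable. Two category bases on $X$ are equivalent if they have the same meager sets and the same Baire sets. Let now $X$ be a real topological vector space whose topology is Polish, with a metric inducing the topology. A category base $(X,\mathcal{C})$ is a perfect base if all members of $\mathcal{C}$ are perfect sets (closed, without isolated points) and for every region $A$ and every $x\in A$ there is a descending sequence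 $(A_n)_{n\ge1}$ of regions with $x\in A_n\subseteq A$ and $\mathrm{diam}(A_n)\le 1/n$ (this does not depend on the choice of the metric). It is a translation base if $\mathcal{C}$ is translation invariant and, for every region $A$ and every countable dense set $D\subseteq X$, the set $\bigcup_{r\in D}(A+r)$ is abundant everywhere. It is a perfect translation base if it is both. $\mathcal{C}$ is linearly invariant if it is translation invariant and $\lambda E\in\mathcal{C}$ for all $E\in\mathcal{C}$ and all real $\lambda\ne0$. A set $B\subseteq X$ is a Bernstein set if both $B$ and $X\setminus B$ meet every nonempty perfect subset of $X$. Theorem 2.10. Assume the continuum hypothesis. Let $X$ be a Polish real topological vector space, and let $(X,\mathcal{C})$ be a perfect translation base satisfying c.c.c., with $\mathcal{C}$ linearly invariant and $\mathrm{card}(\mathcal{C})\le 2^{\aleph_0}$. Then there exist sets $R_1,R_2\subseteq X$ such that (i) both $R_1$ and $R_2$ are rare in $(X,\mathcal{C})$; (ii) $R_1+R_2=\{x+y : x\in R_1,\ y\in R_2\}$ is a Bernstein set in $X$; (iii) both $R_1$ and $R_2$ are meager in every perfect translation base $(X,\mathcal{D})$ that is not equivalent to $(X,\mathcal{C})$.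 -/

import Mathlib

open scoped Pointwise Cardinal

namespace CategoryBase

/-- A region of the family `𝒞` is a nonempty member of `𝒞`. -/
def IsRegion {X : Type*} (𝒞 : Set (Set X)) (A : Set X) : Prop :=
  A ∈ 𝒞 ∧ A.Nonempty

/-- `(X, 𝒞)` is a category base (in the sense of J. C. Morgan II). -/
structure IsCategoryBase {X : Type*} (𝒞 : Set (Set X)) : Prop where
  nonempty : Nonempty X
  /-- Every point of `X` lies in some region. -/
  cover : ∀ x : X, ∃ A, IsRegion 𝒞 A ∧ x ∈ A
  /-- If a region meets the union of few disjoint regions in a set that contains a region, then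
  it meets one of them in a set that contains a region. -/
  exists_inter : ∀ A, IsRegion 𝒞 A → ∀ 𝒟 : Set (Set X), 𝒟.Nonempty →
    (∀ D ∈ 𝒟, IsRegion 𝒞 D) → 𝒟.PairwiseDisjoint id → #𝒟 < #𝒞 →
    (∃ B, IsRegion 𝒞 B ∧ B ⊆ A ∩ ⋃₀ 𝒟) →
    ∃ D ∈ 𝒟, ∃ B, IsRegion 𝒞 B ∧ B ⊆ A ∩ D
  /-- If it meets the union in a set that contains no region, then some subregion misses all of
  them. -/
  exists_disjoint : ∀ A, IsRegion 𝒞 A → ∀ 𝒟 : Set (Set X), 𝒟.Nonempty →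
    (∀ D ∈ 𝒟, IsRegion 𝒞 D) → 𝒟.PairwiseDisjoint id → #𝒟 < #𝒞 →
    (¬ ∃ B, IsRegion 𝒞 B ∧ B ⊆ A ∩ ⋃₀ 𝒟) →
    ∃ B, IsRegion 𝒞 B ∧ B ⊆ A ∧ ∀ D ∈ 𝒟, Disjoint B D

/-- A set is singular if every region contains a subregion disjoint from it. -/
def IsSingular {X : Type*} (𝒞 : Set (Set X)) (S : Set X) : Prop :=
  ∀ A, IsRegion 𝒞 A → ∃ B, IsRegion 𝒞 B ∧ B ⊆ A ∧ Disjoint B S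

/-- A set is meager if it is a countable union of singular sets; otherwise it is abundant. -/
def IsMeager {X : Type*} (𝒞 : Set (Set X)) (S : Set X) : Prop :=
  ∃ T : ℕ → Set X, (∀ n, IsSingular 𝒞 (T n)) ∧ S = ⋃ n, T n

/-- A set is a Baire set if every region contains a subregion in which the set or its complement
is meager. -/
def IsBaire {X : Type*} (𝒞 : Set (Set X)) (S : Set X) : Prop :=
  ∀ A, IsRegion 𝒞 A → ∃ B, IsRegion 𝒞 B ∧ B ⊆ A ∧ (IsMeager 𝒞 (B ∩ S) ∨ IsMeager 𝒞 (B ∩ Sᶜ))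

/-- A set is abundant everywhere if its intersection with every region is abundant. -/
def IsAbundantEverywhere {X : Type*} (𝒞 : Set (Set X)) (S : Set X) : Prop :=
  ∀ A, IsRegion 𝒞 A → ¬ IsMeager 𝒞 (A ∩ S)

/-- A rare set: an uncountable set whose intersection with every meager set is countable. -/
def IsRare {X : Type*} (𝒞 : Set (Set X)) (R : Set X) : Prop :=
  ¬ R.Countable ∧ ∀ M, IsMeager 𝒞 M → (R ∩ M).Countable

/-- The countable chain condition: every family of mutually disjoint regions is countable. -/
def CCC {X : Type*} (𝒞 : Set (Set X)) : Prop :=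
  ∀ 𝒟 : Set (Set X), (∀ D ∈ 𝒟, IsRegion 𝒞 D) → 𝒟.PairwiseDisjoint id → 𝒟.Countable

/-- Two category bases on `X` are equivalent if they have the same meager sets and the same Baire
sets. -/
def Equivalent {X : Type*} (𝒞 𝒟 : Set (Set X)) : Prop :=
  {S | IsMeager 𝒞 S} = {S | IsMeager 𝒟 S} ∧ {S | IsBaire 𝒞 S} = {S | IsBaire 𝒟 S}

/-- A perfect base on a metrizable space: a category base of perfect sets such that every point
`x` of every region `A` has a descending sequence of subregions of `A` that contain `x`, the
`n`-th of diameter at most `1 / n` (indexed here from `0`) for a metric inducing the topology.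
By `isPerfectBase_iff` below the choice of that metric is immaterial. -/
structure IsPerfectBase {X : Type*} [t : TopologicalSpace X] (𝒞 : Set (Set X)) : Prop
    extends IsCategoryBase 𝒞 where
  perfect : ∀ A ∈ 𝒞, Perfect A
  shrinking : ∃ m : MetricSpace X, m.toUniformSpace.toTopologicalSpace = t ∧
    ∀ A, IsRegion 𝒞 A → ∀ x ∈ A, ∃ S : ℕ → Set X, Antitone S ∧
      ∀ n, IsRegion 𝒞 (S n) ∧ S n ⊆ A ∧ x ∈ S n ∧ Metric.ediam (S n) ≤ ((n : ENNReal) + 1)⁻¹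

/-- The family is invariant under all translations. -/
def TranslationInvariant {X : Type*} [AddCommGroup X] (𝒞 : Set (Set X)) : Prop :=
  ∀ E ∈ 𝒞, ∀ r : X, (fun x => x + r) '' E ∈ 𝒞

/-- A translation base: a translation invariant category base such that the union of the
translates of any region by the elements of any countable dense set is abundant everywhere. -/
structure IsTranslationBase {X : Type*} [AddCommGroup X] [TopologicalSpace X]
    (𝒞 : Set (Set X)) : Prop extends IsCategoryBase 𝒞 where
  translationInvariant : TranslationInvariant 𝒞
  abundantEverywhere : ∀ A, IsRegion 𝒞 A → ∀ D : Set X, D.Countable → Dense D →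
    IsAbundantEverywhere 𝒞 (⋃ r ∈ D, (fun x => x + r) '' A)

/-- A perfect translation base. -/
def IsPerfectTranslationBase {X : Type*} [AddCommGroup X] [TopologicalSpace X]
    (𝒞 : Set (Set X)) : Prop :=
  IsPerfectBase 𝒞 ∧ IsTranslationBase 𝒞

/-- The family is invariant under translations and under multiplication by nonzero reals. -/
def LinearlyInvariant {X : Type*} [AddCommGroup X] [Module ℝ X] (𝒞 : Set (Set X)) : Prop :=
  TranslationInvariant 𝒞 ∧ ∀ E ∈ 𝒞, ∀ c : ℝ, c ≠ 0 → c • E ∈ 𝒞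

/-- A Bernstein set: it and its complement both meet every nonempty perfect set. -/
def IsBernstein {X : Type*} [TopologicalSpace X] (B : Set X) : Prop :=
  ∀ P : Set X, Perfect P → P.Nonempty → (B ∩ P).Nonempty ∧ (Bᶜ ∩ P).Nonempty

/-- Independence of the metric: the shrinking condition says that every point of a region has
arbitrarily small subregions around it. -/
theorem isPerfectBase_iff {X : Type*} [m : MetricSpace X] (𝒞 : Set (Set X)) :
    IsPerfectBase 𝒞 ↔ IsCategoryBase 𝒞 ∧ (∀ A ∈ 𝒞, Perfect A) ∧
      ∀ A, IsRegion 𝒞 A → ∀ x ∈ A, ∀ U ∈ nhds x, ∃ B, IsRegion 𝒞 B ∧ B ⊆ A ∩ U ∧ x ∈ B := by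
  constructor
  · rintro ⟨h1, h2, m', hm', h3⟩
    refine ⟨h1, h2, fun A hA x hx U hU => ?_⟩
    obtain ⟨S, -, hS⟩ := h3 A hA x hx
    rw [← hm'] at hU
    obtain ⟨ε, hε, hεU⟩ := EMetric.mem_nhds_iff.1 hU
    obtain ⟨n, hn⟩ := ENNReal.exists_inv_nat_lt hε.ne'
    obtain ⟨h, hA', hxS, hd⟩ := hS n
    refine ⟨S n, h, Set.subset_inter hA' fun y hy => hεU ?_, hxS⟩
    refine lt_of_le_of_lt ((Metric.edist_le_ediam_of_mem hy hxS).trans (hd.trans ?_)) hn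
    exact ENNReal.inv_le_inv.2 le_self_add
  · rintro ⟨h1, h2, h3⟩
    refine ⟨h1, h2, m, rfl, fun A hA x hx => ?_⟩
    have step : ∀ (n : ℕ) (A : {A // IsRegion 𝒞 A ∧ x ∈ A}), ∃ B : {A // IsRegion 𝒞 A ∧ x ∈ A},
        B.1 ⊆ A.1 ∧ Metric.ediam B.1 ≤ ((n : ENNReal) + 1)⁻¹ := by
      rintro n ⟨A, hA, hx⟩
      have hpos : (0 : ENNReal) < ((n : ENNReal) + 1)⁻¹ / 2 := by
        refine ENNReal.div_pos ?_ (by simp)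
        exact ENNReal.inv_ne_zero.2 (by finiteness)
      obtain ⟨B, hB, hBA, hxB⟩ := h3 A hA x hx _ (Metric.eball_mem_nhds x hpos)
      refine ⟨⟨B, hB, hxB⟩, fun y hy => (hBA hy).1, ?_⟩
      refine (Metric.ediam_mono fun y hy => (hBA hy).2).trans (Metric.ediam_eball_le.trans ?_)
      rw [ENNReal.mul_div_cancel (by simp) (by simp)]
    choose f hf hf' using step
    let S : ℕ → {A // IsRegion 𝒞 A ∧ x ∈ A} := fun n =>
      Nat.rec (f 0 ⟨A, hA, hx⟩) (fun k B => f (k + 1) B) n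
    have hanti : Antitone fun n => (S n).1 := antitone_nat_of_succ_le fun n => hf (n + 1) (S n)
    refine ⟨fun n => (S n).1, hanti, fun n => ⟨(S n).2.1, ?_, (S n).2.2, ?_⟩⟩
    · exact (hanti (Nat.zero_le n)).trans (hf 0 ⟨A, hA, hx⟩)
    · cases n with
      | zero => exact hf' 0 _
      | succ k => exact hf' (k + 1) (S k)

end CategoryBase

/-! Two independent arguments are combined.

Rare sets are meager in every inequivalent base. In a perfect c.c.c. base, meager sets have Borel
meager hulls and Baire sets are Borel up to a meager set, so the Borel meager sets determine the
base up to equivalence. If `𝒟` is not equivalent to `𝒞`, some Borel set is therefore meager in one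
and abundant in the other. Its translates along a countable dense set stay meager in the first base;
in the second they are comeager, since the set contains a region up to a meager set. Thus some `N`
is `𝒞`-meager with `Nᶜ` `𝒟`-meager (`exists_isMeager_isMeager_compl_of_not_equivalent`). A rare `R`
meets `N` in a countable, hence `𝒟`-meager, set.

The sets themselves come from a transfinite recursion (`exists_rare_add_bernstein`). By CH the Borel
sets are listed with countable initial segments. Each stage picks `x` for `R₁` and `y` for `R₂`
outside the meager sets listed so far, with `x + y` in the current set if it is perfect, and a point
`w` of that set to be kept out of `R₁ + R₂`. To solve `x + y = p` off a meager `M`, take `x` outside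
`M ∪ (p - M)`, which is meager and so not all of `X`. -/

namespace CategoryBase

open Set Topology

/-- Dependent choice along a well-founded relation. -/
theorem exists_wellFounded_choice {T Y : Type*} {r : T → T → Prop} (hr : WellFounded r)
    (R : ∀ a : T, (∀ b, r b a → Y) → Y → Prop) (h : ∀ a g, ∃ y, R a g y) :
    ∃ f : T → Y, ∀ a, R a (fun b _ => f b) (f a) := by
  choose F hF using h
  refine ⟨hr.fix fun a g => F a g, fun a => ?_⟩
  rw [hr.fix_eq]
  exact hF a _

theorem exists_isWellOrder_card_lt (T : Type*) :
    ∃ r : T → T → Prop, IsWellOrder T r ∧ ∀ a, #{b | r b a} < #T := by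
  obtain ⟨_, _, h⟩ := Cardinal.exists_ord_eq_type_lt T
  exact ⟨(· < ·), inferInstance, fun a => Cardinal.mk_Iio_lt a h⟩

/-! ### Meager and Baire sets in an arbitrary category base. -/

section Basic

variable {X : Type*} {𝒞 : Set (Set X)} {S T A B E F : Set X}

theorem IsSingular.mono (hS : IsSingular 𝒞 S) (h : T ⊆ S) : IsSingular 𝒞 T := fun A hA =>
  let ⟨B, hB, hBA, hd⟩ := hS A hA
  ⟨B, hB, hBA, hd.mono_right h⟩

theorem IsSingular.isMeager (hS : IsSingular 𝒞 S) : IsMeager 𝒞 S :=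
  ⟨fun _ => S, fun _ => hS, (iUnion_const S).symm⟩

theorem IsMeager.mono (hS : IsMeager 𝒞 S) (h : T ⊆ S) : IsMeager 𝒞 T := by
  obtain ⟨U, hU, rfl⟩ := hS
  refine ⟨fun n => T ∩ U n, fun n => (hU n).mono inter_subset_right, ?_⟩
  rw [← inter_iUnion, inter_eq_left.2 h]

theorem IsMeager.iUnion_nat {S : ℕ → Set X} (hS : ∀ n, IsMeager 𝒞 (S n)) :
    IsMeager 𝒞 (⋃ n, S n) := by
  choose T hT hST using hS
  refine ⟨fun n => T n.unpair.1 n.unpair.2, fun n => hT _ _, ?_⟩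
  rw [iUnion_unpair (fun i j => T i j)]
  exact iUnion_congr hST

theorem isMeager_empty : IsMeager 𝒞 (∅ : Set X) :=
  IsSingular.isMeager fun A hA => ⟨A, hA, subset_rfl, disjoint_empty A⟩

theorem IsMeager.biUnion {ι : Type*} {I : Set ι} (hI : I.Countable) {S : ι → Set X}
    (hS : ∀ i ∈ I, IsMeager 𝒞 (S i)) : IsMeager 𝒞 (⋃ i ∈ I, S i) := by
  rcases I.eq_empty_or_nonempty with rfl | hne
  · simpa using isMeager_empty
  · obtain ⟨f, rfl⟩ := hI.exists_eq_range hne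
    rw [biUnion_range]
    exact IsMeager.iUnion_nat fun n => hS _ (mem_range_self n)

theorem IsMeager.union (hS : IsMeager 𝒞 S) (hT : IsMeager 𝒞 T) : IsMeager 𝒞 (S ∪ T) := by
  rw [union_eq_iUnion]
  have h : IsMeager 𝒞 (⋃ b ∈ (univ : Set Bool), cond b S T) :=
    IsMeager.biUnion (to_countable _) (by rintro (_ | _) - <;> assumption)
  exact h.mono (by simp)

/-- Every family of regions that is dense from below contains a disjoint one that every region
meets in a set containing a region. -/
theorem IsCategoryBase.exists_disjoint_refinement (h : IsCategoryBase 𝒞) {P : Set X → Prop}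
    (hP : ∀ A, IsRegion 𝒞 A → ∃ B, IsRegion 𝒞 B ∧ B ⊆ A ∧ P B) :
    ∃ 𝓜 : Set (Set X), (∀ B ∈ 𝓜, IsRegion 𝒞 B ∧ P B) ∧ 𝓜.PairwiseDisjoint id ∧
      ∀ A, IsRegion 𝒞 A → ∃ B ∈ 𝓜, ∃ G, IsRegion 𝒞 G ∧ G ⊆ A ∩ B := by
  obtain ⟨r, hr, hcard⟩ := exists_isWellOrder_card_lt 𝒞
  -- At each region `a` choose a subregion with `P` disjoint from all earlier choices; the value `∅`
  -- records that none exists.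
  obtain ⟨f, hf⟩ := exists_wellFounded_choice (Y := Set X) hr.wf
    (fun a g y => (y = ∅ ∧ ¬ ∃ B, IsRegion 𝒞 B ∧ B ⊆ a.1 ∧ P B ∧ ∀ b hb, Disjoint B (g b hb)) ∨
      (IsRegion 𝒞 y ∧ y ⊆ a.1 ∧ P y ∧ ∀ b hb, Disjoint y (g b hb)))
    (fun a g => by
      by_cases hB : ∃ B, IsRegion 𝒞 B ∧ B ⊆ a.1 ∧ P B ∧ ∀ b hb, Disjoint B (g b hb)
      · obtain ⟨B, hB⟩ := hB
        exact ⟨B, Or.inr hB⟩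
      · exact ⟨∅, Or.inl ⟨rfl, hB⟩⟩)
  have hreg : ∀ a, (f a).Nonempty →
      IsRegion 𝒞 (f a) ∧ f a ⊆ a.1 ∧ P (f a) ∧ ∀ b, r b a → Disjoint (f a) (f b) := fun a ha =>
    (hf a).resolve_left fun h => ha.ne_empty h.1
  refine ⟨{B | B ∈ range f ∧ B.Nonempty}, ?_, ?_, fun A hA => ?_⟩
  · rintro _ ⟨⟨a, rfl⟩, ha⟩
    exact ⟨(hreg a ha).1, (hreg a ha).2.2.1⟩
  · rintro _ ⟨⟨a, rfl⟩, ha⟩ _ ⟨⟨b, rfl⟩, hb⟩ hab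
    rcases trichotomous_of r a b with h' | h' | h'
    · exact ((hreg b hb).2.2.2 a h').symm
    · exact absurd (congrArg f h') hab
    · exact (hreg a ha).2.2.2 b h'
  · rcases hf ⟨A, hA.1⟩ with ⟨-, hno⟩ | hyes
    -- Nothing could be chosen at `A`, so no subregion of `A` misses all earlier choices. These
    -- number fewer than `#𝒞`, so the two category base axioms yield one of them meeting `A` in a
    -- set containing a region.
    · set 𝒟 : Set (Set X) := {B | B ∈ f '' {b | r b ⟨A, hA.1⟩} ∧ B.Nonempty}
      have key : ∀ B, IsRegion 𝒞 B → B ⊆ A → ¬ ∀ D ∈ 𝒟, Disjoint B D := by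
        intro B hB hBA hd
        obtain ⟨G, hG, hGB, hPG⟩ := hP B hB
        refine hno ⟨G, hG, hGB.trans hBA, hPG, fun b hb => ?_⟩
        rcases (f b).eq_empty_or_nonempty with he | he
        · change Disjoint G (f b)
          exact he.symm ▸ disjoint_empty G
        · exact (hd _ ⟨⟨b, hb, rfl⟩, he⟩).mono_left hGB
      have hne : 𝒟.Nonempty := by
        by_contra hne
        rw [not_nonempty_iff_eq_empty] at hne
        exact key A hA subset_rfl (by simp [hne])
      have hD : ∀ D ∈ 𝒟, IsRegion 𝒞 D := by
        rintro _ ⟨⟨a, -, rfl⟩, ha⟩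
        exact (hreg a ha).1
      have hdisj : 𝒟.PairwiseDisjoint id := by
        rintro _ ⟨⟨a, -, rfl⟩, ha⟩ _ ⟨⟨b, -, rfl⟩, hb⟩ hab
        rcases trichotomous_of r a b with h' | h' | h'
        · exact ((hreg b hb).2.2.2 a h').symm
        · exact absurd (congrArg f h') hab
        · exact (hreg a ha).2.2.2 b h'
      have hlt : #𝒟 < #𝒞 :=
        ((Cardinal.mk_le_mk_of_subset fun B hB => hB.1).trans Cardinal.mk_image_le).trans_lt
          (hcard ⟨A, hA.1⟩)
      by_cases hU : ∃ B, IsRegion 𝒞 B ∧ B ⊆ A ∩ ⋃₀ 𝒟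
      · obtain ⟨D, hD𝒟, G, hG⟩ := h.exists_inter A hA 𝒟 hne hD hdisj hlt hU
        exact ⟨D, ⟨image_subset_range _ _ hD𝒟.1, hD𝒟.2⟩, G, hG⟩
      · obtain ⟨B, hB, hBA, hd⟩ := h.exists_disjoint A hA 𝒟 hne hD hdisj hlt hU
        exact absurd hd (key B hB hBA)
    · exact ⟨_, ⟨mem_range_self _, hyes.1.2⟩, _, hyes.1, subset_inter hyes.2.1 subset_rfl⟩

/-- The Banach category theorem: a locally meager set is meager. -/
theorem IsCategoryBase.isMeager_of_locally (h : IsCategoryBase 𝒞)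
    (hS : ∀ A, IsRegion 𝒞 A → ∃ B, IsRegion 𝒞 B ∧ B ⊆ A ∧ IsMeager 𝒞 (B ∩ S)) :
    IsMeager 𝒞 S := by
  obtain ⟨𝓜, h𝓜, hdisj, hmeet⟩ := h.exists_disjoint_refinement hS
  choose! T hT hST using fun B hB => (h𝓜 B hB).2
  have hsing : IsSingular 𝒞 (S \ ⋃₀ 𝓜) := by
    intro A hA
    obtain ⟨B, hB, G, hG, hGAB⟩ := hmeet A hA
    refine ⟨G, hG, hGAB.trans inter_subset_left, disjoint_left.2 fun x hx hx' => hx'.2 ?_⟩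
    exact ⟨B, hB, (hGAB hx).2⟩
  -- Members of `𝓜` are disjoint, so inside `B` only the piece `T B n` matters and singularity
  -- survives even an uncountable union.
  have hsing' : ∀ n, IsSingular 𝒞 (⋃ B ∈ 𝓜, T B n) := by
    intro n A hA
    obtain ⟨B, hB, G, hG, hGAB⟩ := hmeet A hA
    obtain ⟨H, hH, hHG, hHT⟩ := hT B hB n G hG
    refine ⟨H, hH, hHG.trans (hGAB.trans inter_subset_left), disjoint_left.2 fun x hx hx' => ?_⟩
    obtain ⟨C, hC, hxC⟩ := mem_iUnion₂.1 hx'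
    have hxC' : x ∈ C := (hST C hC ▸ mem_iUnion.2 ⟨n, hxC⟩ : x ∈ C ∩ S).1
    have hCB : B = C := hdisj.elim_set hB hC x (hGAB (hHG hx)).2 hxC'
    subst hCB
    exact disjoint_left.1 hHT hx hxC
  refine (hsing.isMeager.union (IsMeager.iUnion_nat fun n => (hsing' n).isMeager)).mono
    fun x hx => ?_
  by_cases hx' : x ∈ ⋃₀ 𝓜
  · obtain ⟨B, hB, hxB⟩ := hx'
    have hxT : x ∈ ⋃ n, T B n := hST B hB ▸ ⟨hxB, hx⟩
    obtain ⟨n, hn⟩ := mem_iUnion.1 hxT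
    exact Or.inr (mem_iUnion.2 ⟨n, mem_iUnion₂.2 ⟨B, hB, hn⟩⟩)
  · exact Or.inl ⟨hx, hx'⟩

theorem IsCategoryBase.exists_subset_inter_or_disjoint (h : IsCategoryBase 𝒞)
    (hnt : 𝒞.Nontrivial) (hA : IsRegion 𝒞 A) (hB : IsRegion 𝒞 B) :
    ∃ G, IsRegion 𝒞 G ∧ G ⊆ A ∧ (G ⊆ B ∨ Disjoint G B) := by
  by_cases hG : ∃ G, IsRegion 𝒞 G ∧ G ⊆ A ∩ B
  · obtain ⟨G, hG, hGAB⟩ := hG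
    exact ⟨G, hG, hGAB.trans inter_subset_left, Or.inl (hGAB.trans inter_subset_right)⟩
  · have hlt : #({B} : Set (Set X)) < #𝒞 := by
      have := hnt.coe_sort
      simpa using Cardinal.one_lt_iff_nontrivial.2 this
    obtain ⟨G, hG, hGA, hd⟩ := h.exists_disjoint A hA {B} (singleton_nonempty B) (by simpa using hB)
      (pairwiseDisjoint_singleton B id) hlt (by simpa using hG)
    exact ⟨G, hG, hGA, Or.inr (hd B rfl)⟩

/-- The Banach category theorem inside a region. -/
theorem IsCategoryBase.isMeager_inter_of_locally (h : IsCategoryBase 𝒞) (hnt : 𝒞.Nontrivial)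
    (hA : IsRegion 𝒞 A)
    (hS : ∀ B, IsRegion 𝒞 B → B ⊆ A → ∃ G, IsRegion 𝒞 G ∧ G ⊆ B ∧ IsMeager 𝒞 (G ∩ S)) :
    IsMeager 𝒞 (A ∩ S) := by
  refine h.isMeager_of_locally fun C hC => ?_
  obtain ⟨B, hB, hBC, hBA | hd⟩ := h.exists_subset_inter_or_disjoint hnt hC hA
  · obtain ⟨G, hG, hGB, hm⟩ := hS B hB hBA
    exact ⟨G, hG, hGB.trans hBC, hm.mono (inter_subset_inter_right G inter_subset_right)⟩
  · refine ⟨B, hB, hBC, ?_⟩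
    rw [← inter_assoc, hd.inter_eq, empty_inter]
    exact isMeager_empty

theorem IsBaire.compl (hS : IsBaire 𝒞 S) : IsBaire 𝒞 Sᶜ := fun A hA =>
  let ⟨B, hB, hBA, hm⟩ := hS A hA
  ⟨B, hB, hBA, by rwa [compl_compl, or_comm]⟩

/-- If no `S n` is comeager in a subregion of `A`, each is locally meager in `A`, hence meager there
by the Banach category theorem. -/
theorem IsCategoryBase.isBaire_iUnion (h : IsCategoryBase 𝒞) (hnt : 𝒞.Nontrivial)
    {S : ℕ → Set X} (hS : ∀ n, IsBaire 𝒞 (S n)) : IsBaire 𝒞 (⋃ n, S n) := by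
  intro A hA
  by_cases hex : ∃ n B, IsRegion 𝒞 B ∧ B ⊆ A ∧ IsMeager 𝒞 (B ∩ (S n)ᶜ)
  · obtain ⟨n, B, hB, hBA, hm⟩ := hex
    exact ⟨B, hB, hBA, Or.inr <| hm.mono <| inter_subset_inter_right B <|
      compl_subset_compl.2 <| subset_iUnion S n⟩
  · refine ⟨A, hA, subset_rfl, Or.inl ?_⟩
    rw [inter_iUnion]
    refine IsMeager.iUnion_nat fun n => h.isMeager_inter_of_locally hnt hA fun B hB hBA => ?_
    obtain ⟨G, hG, hGB, hm | hm⟩ := hS n B hB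
    · exact ⟨G, hG, hGB, hm⟩
    · exact absurd ⟨n, G, hG, hGB.trans hBA, hm⟩ hex

theorem IsMeager.isBaire (hS : IsMeager 𝒞 S) : IsBaire 𝒞 S := fun A hA =>
  ⟨A, hA, subset_rfl, Or.inl (hS.mono inter_subset_right)⟩

theorem IsBaire.of_diff (hF : IsBaire 𝒞 F) (h₁ : IsMeager 𝒞 (E \ F)) (h₂ : IsMeager 𝒞 (F \ E)) :
    IsBaire 𝒞 E := by
  intro A hA
  obtain ⟨B, hB, hBA, hm | hm⟩ := hF A hA
  · refine ⟨B, hB, hBA, Or.inl ((hm.union h₁).mono fun x hx => ?_)⟩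
    by_cases hxF : x ∈ F
    exacts [Or.inl ⟨hx.1, hxF⟩, Or.inr ⟨hx.2, hxF⟩]
  · refine ⟨B, hB, hBA, Or.inr ((hm.union h₂).mono fun x hx => ?_)⟩
    by_cases hxF : x ∈ F
    exacts [Or.inr ⟨hxF, hx.2⟩, Or.inl ⟨hx.1, hxF⟩]

/-- An abundant Baire set contains a region up to a meager set. -/
theorem IsCategoryBase.exists_isMeager_diff (h : IsCategoryBase 𝒞) (hE : IsBaire 𝒞 E)
    (hab : ¬ IsMeager 𝒞 E) : ∃ B, IsRegion 𝒞 B ∧ IsMeager 𝒞 (B \ E) := by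
  by_contra! hno
  refine hab (h.isMeager_of_locally fun A hA => ?_)
  obtain ⟨B, hB, hBA, hm | hm⟩ := hE A hA
  · exact ⟨B, hB, hBA, hm⟩
  · exact absurd hm (hno B hB)

/-- In a c.c.c. base, disjoint abundant Baire sets are countably many. -/
theorem IsCategoryBase.countable_of_pairwiseDisjoint (h : IsCategoryBase 𝒞) (hnt : 𝒞.Nontrivial)
    (hccc : CCC 𝒞) {𝓔 : Set (Set X)} (hE : ∀ E ∈ 𝓔, IsBaire 𝒞 E ∧ ¬ IsMeager 𝒞 E)
    (hdisj : 𝓔.PairwiseDisjoint id) : 𝓔.Countable := by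
  -- Regions meeting at most one member of `𝓔` abundantly are dense: either some `E` fills a
  -- subregion up to a meager set, which makes the others meager there, or every `E` is meager in
  -- `A`. An abundant `E` must meet some member of the countable family `𝓜` abundantly, and each
  -- member serves at most one `E`.
  obtain ⟨𝓜, h𝓜, hd, hmeet⟩ := h.exists_disjoint_refinement
    (P := fun A => {E ∈ 𝓔 | ¬ IsMeager 𝒞 (A ∩ E)}.Subsingleton) (fun A hA => by
      by_cases hex : ∃ E ∈ 𝓔, ∃ B, IsRegion 𝒞 B ∧ B ⊆ A ∧ IsMeager 𝒞 (B ∩ Eᶜ)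
      · obtain ⟨E, hE𝓔, B, hB, hBA, hm⟩ := hex
        have huniq : ∀ F ∈ 𝓔, ¬ IsMeager 𝒞 (B ∩ F) → F = E := by
          intro F hF hab
          by_contra hne
          exact hab (hm.mono (inter_subset_inter_right B
            (subset_compl_iff_disjoint_right.2 (hdisj hF hE𝓔 hne))))
        exact ⟨B, hB, hBA, fun F hF G hG =>
          (huniq F hF.1 hF.2).trans (huniq G hG.1 hG.2).symm⟩
      · refine ⟨A, hA, subset_rfl, fun E hE' => absurd ?_ hE'.2⟩
        refine h.isMeager_inter_of_locally hnt hA fun B hB hBA => ?_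
        obtain ⟨G, hG, hGB, hm | hm⟩ := (hE E hE'.1).1 B hB
        · exact ⟨G, hG, hGB, hm⟩
        · exact absurd ⟨E, hE'.1, G, hG, hGB.trans hBA, hm⟩ hex)
  have hcount : 𝓜.Countable := hccc 𝓜 (fun B hB => (h𝓜 B hB).1) hd
  refine Countable.mono (fun E hE' => ?_)
    (hcount.biUnion fun A hA => (h𝓜 A hA).2.countable)
  by_contra hno
  refine (hE E hE').2 ?_
  have hsing : IsSingular 𝒞 (⋃₀ 𝓜)ᶜ := by
    intro A hA
    obtain ⟨B, hB, G, hG, hGAB⟩ := hmeet A hA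
    exact ⟨G, hG, hGAB.trans inter_subset_left,
      disjoint_left.2 fun x hx hx' => hx' ⟨B, hB, (hGAB hx).2⟩⟩
  have hm : IsMeager 𝒞 (⋃ A ∈ 𝓜, A ∩ E) := IsMeager.biUnion hcount fun A hA => by
    by_contra hab
    exact hno (mem_iUnion₂.2 ⟨A, hA, hE', hab⟩)
  refine (hsing.isMeager.union hm).mono fun x hx => ?_
  by_cases hx' : x ∈ ⋃₀ 𝓜
  · obtain ⟨B, hB, hxB⟩ := hx'
    exact Or.inr (mem_iUnion₂.2 ⟨B, hB, hxB, hx⟩)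
  · exact Or.inl hx'

/-- A bijection that preserves the regions in both directions preserves meager sets. -/
theorem IsMeager.image_equiv (e : X ≃ X) (h₁ : ∀ A ∈ 𝒞, e '' A ∈ 𝒞)
    (h₂ : ∀ A ∈ 𝒞, e.symm '' A ∈ 𝒞) (hS : IsMeager 𝒞 S) : IsMeager 𝒞 (e '' S) := by
  obtain ⟨T, hT, rfl⟩ := hS
  refine ⟨fun n => e '' T n, fun n A hA => ?_, image_iUnion⟩
  obtain ⟨B, hB, hBA, hd⟩ := hT n (e.symm '' A) ⟨h₂ A hA.1, hA.2.image _⟩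
  refine ⟨e '' B, ⟨h₁ B hB.1, hB.2.image _⟩, ?_, (disjoint_image_iff e.injective).2 hd⟩
  refine (image_mono hBA).trans ?_
  rw [← image_comp]
  simp

end Basic

/-! ### Perfect bases: Borel sets are Baire, and c.c.c. gives Borel hulls. -/

section Perfect

variable {X : Type*} [TopologicalSpace X] {𝒞 𝒟 : Set (Set X)} {S E : Set X}

theorem IsPerfectBase.exists_subset_of_mem_nhds {X : Type*} [t : TopologicalSpace X]
    {𝒞 : Set (Set X)} (h : IsPerfectBase 𝒞) {A : Set X} (hA : IsRegion 𝒞 A) {x : X} (hx : x ∈ A)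
    {U : Set X} (hU : U ∈ 𝓝 x) : ∃ B, IsRegion 𝒞 B ∧ B ⊆ A ∩ U ∧ x ∈ B := by
  obtain ⟨m, hm, -⟩ := h.shrinking
  subst hm
  exact ((isPerfectBase_iff 𝒞).1 h).2.2 A hA x hx U hU

theorem IsPerfectBase.exists_notMem [T1Space X] (h : IsPerfectBase 𝒞) {A : Set X}
    (hA : IsRegion 𝒞 A) (x : X) : ∃ B, IsRegion 𝒞 B ∧ B ⊆ A ∧ x ∉ B := by
  have hy : ∃ y ∈ A, y ≠ x := by
    by_cases hx : x ∈ A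
    · obtain ⟨y, hy, hyx⟩ := preperfect_iff_nhds.1 (h.perfect A hA.1).acc x hx univ Filter.univ_mem
      exact ⟨y, hy.2, hyx⟩
    · obtain ⟨y, hy⟩ := hA.2
      exact ⟨y, hy, fun hyx => hx (hyx ▸ hy)⟩
  obtain ⟨y, hyA, hyx⟩ := hy
  obtain ⟨B, hB, hBA, -⟩ := h.exists_subset_of_mem_nhds hA hyA (isOpen_ne.mem_nhds hyx)
  exact ⟨B, hB, fun z hz => (hBA hz).1, fun hx => (hBA hx).2 rfl⟩

theorem IsPerfectBase.nontrivial [T1Space X] (h : IsPerfectBase 𝒞) : 𝒞.Nontrivial := by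
  obtain ⟨x⟩ := h.nonempty
  obtain ⟨A, hA, hx⟩ := h.cover x
  obtain ⟨B, hB, -, hxB⟩ := h.exists_notMem hA x
  exact ⟨A, hA.1, B, hB.1, fun hAB => hxB (hAB ▸ hx)⟩

theorem IsPerfectBase.isMeager_of_countable [T1Space X] (h : IsPerfectBase 𝒞)
    (hS : S.Countable) : IsMeager 𝒞 S := by
  rw [← biUnion_of_singleton S]
  refine IsMeager.biUnion hS fun x _ => IsSingular.isMeager fun A hA => ?_
  obtain ⟨B, hB, hBA, hx⟩ := h.exists_notMem hA x
  exact ⟨B, hB, hBA, disjoint_singleton_right.2 hx⟩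

/-- A region not contained in `S` has a point off `S`, around which it shrinks to a subregion
missing `S`. -/
theorem IsPerfectBase.isBaire_of_isClosed (h : IsPerfectBase 𝒞) (hS : IsClosed S) :
    IsBaire 𝒞 S := by
  intro A hA
  by_cases hAS : A ⊆ S
  · refine ⟨A, hA, subset_rfl, Or.inr ?_⟩
    rw [← sdiff_eq, sdiff_eq_empty.2 hAS]
    exact isMeager_empty
  · obtain ⟨x, hx, hxS⟩ := not_subset.1 hAS
    obtain ⟨B, hB, hBA, -⟩ := h.exists_subset_of_mem_nhds hA hx (hS.isOpen_compl.mem_nhds hxS)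
    refine ⟨B, hB, fun y hy => (hBA hy).1, Or.inl ?_⟩
    rw [(disjoint_left.2 fun y hy => (hBA hy).2 : Disjoint B S).inter_eq]
    exact isMeager_empty

theorem IsPerfectBase.isBaire_of_measurableSet [T1Space X] [MeasurableSpace X] [BorelSpace X]
    (h : IsPerfectBase 𝒞) (hS : MeasurableSet S) : IsBaire 𝒞 S := by
  rw [BorelSpace.measurable_eq (α := X), borel_eq_generateFrom_isClosed] at hS
  induction hS with
  | basic F hF => exact h.isBaire_of_isClosed hF
  | empty => exact isMeager_empty.isBaire
  | compl F _ ih => exact ih.compl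
  | iUnion F _ ih => exact h.isBaire_iUnion h.nontrivial ih

/-- In a perfect c.c.c. base, every singular set lies in a measurable singular set. -/
theorem IsSingular.exists_measurable_superset [MeasurableSpace X] [BorelSpace X]
    (h : IsPerfectBase 𝒞) (hccc : CCC 𝒞) (hS : IsSingular 𝒞 S) :
    ∃ T, MeasurableSet T ∧ IsSingular 𝒞 T ∧ S ⊆ T := by
  obtain ⟨𝓜, h𝓜, hd, hmeet⟩ := h.exists_disjoint_refinement hS
  refine ⟨(⋃₀ 𝓜)ᶜ, (MeasurableSet.sUnion (hccc 𝓜 (fun B hB => (h𝓜 B hB).1) hd) fun B hB =>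
    (h.perfect B (h𝓜 B hB).1.1).closed.measurableSet).compl, fun A hA => ?_, fun x hx => ?_⟩
  · obtain ⟨B, hB, G, hG, hGAB⟩ := hmeet A hA
    exact ⟨G, hG, hGAB.trans inter_subset_left,
      disjoint_left.2 fun x hx hx' => hx' ⟨B, hB, (hGAB hx).2⟩⟩
  · rintro ⟨B, hB, hxB⟩
    exact disjoint_left.1 (h𝓜 B hB).2 hxB hx

/-- In a perfect c.c.c. base, every meager set lies in a measurable meager set. -/
theorem IsMeager.exists_measurable_superset [MeasurableSpace X] [BorelSpace X]
    (h : IsPerfectBase 𝒞) (hccc : CCC 𝒞) (hS : IsMeager 𝒞 S) :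
    ∃ T, MeasurableSet T ∧ IsMeager 𝒞 T ∧ S ⊆ T := by
  obtain ⟨U, hU, rfl⟩ := hS
  choose T hT hTs hUT using fun n => (hU n).exists_measurable_superset h hccc
  exact ⟨⋃ n, T n, MeasurableSet.iUnion hT, ⟨T, hTs, rfl⟩, iUnion_mono hUT⟩

/-- In a perfect c.c.c. base, every Baire set is measurable up to a meager set. -/
theorem IsBaire.exists_measurable [MeasurableSpace X] [BorelSpace X]
    (h : IsPerfectBase 𝒞) (hccc : CCC 𝒞) (hS : IsBaire 𝒞 S) :
    ∃ F, MeasurableSet F ∧ IsMeager 𝒞 (S \ F) ∧ IsMeager 𝒞 (F \ S) := by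
  obtain ⟨𝓜, h𝓜, hd, hmeet⟩ := h.exists_disjoint_refinement hS
  have hcount : 𝓜.Countable := hccc 𝓜 (fun B hB => (h𝓜 B hB).1) hd
  have hsing : IsSingular 𝒞 (⋃₀ 𝓜)ᶜ := by
    intro A hA
    obtain ⟨B, hB, G, hG, hGAB⟩ := hmeet A hA
    exact ⟨G, hG, hGAB.trans inter_subset_left,
      disjoint_left.2 fun x hx hx' => hx' ⟨B, hB, (hGAB hx).2⟩⟩
  have hcount₁ : {B ∈ 𝓜 | IsMeager 𝒞 (B ∩ Sᶜ)}.Countable := hcount.mono (sep_subset _ _)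
  have hcount₂ : {B ∈ 𝓜 | IsMeager 𝒞 (B ∩ S)}.Countable := hcount.mono (sep_subset _ _)
  have hm₁ : IsMeager 𝒞 (⋃ B ∈ {B ∈ 𝓜 | IsMeager 𝒞 (B ∩ Sᶜ)}, B ∩ Sᶜ) :=
    IsMeager.biUnion hcount₁ fun B hB => hB.2
  have hm₂ : IsMeager 𝒞 (⋃ B ∈ {B ∈ 𝓜 | IsMeager 𝒞 (B ∩ S)}, B ∩ S) :=
    IsMeager.biUnion hcount₂ fun B hB => hB.2
  refine ⟨⋃ B ∈ {B ∈ 𝓜 | IsMeager 𝒞 (B ∩ Sᶜ)}, B, MeasurableSet.biUnion hcount₁ fun B hB =>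
    (h.perfect B (h𝓜 B hB.1).1.1).closed.measurableSet, ?_, ?_⟩
  · refine (hsing.isMeager.union hm₂).mono fun x hx => ?_
    by_cases hx' : x ∈ ⋃₀ 𝓜
    · obtain ⟨B, hB, hxB⟩ := hx'
      rcases (h𝓜 B hB).2 with hm | hm
      · exact Or.inr (mem_iUnion₂.2 ⟨B, ⟨hB, hm⟩, hxB, hx.1⟩)
      · exact absurd (mem_iUnion₂.2 ⟨B, ⟨hB, hm⟩, hxB⟩) hx.2
    · exact Or.inl hx'
  · refine hm₁.mono ?_
    rintro x ⟨hx, hxS⟩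
    obtain ⟨B, hB, hxB⟩ := mem_iUnion₂.1 hx
    exact mem_iUnion₂.2 ⟨B, hB, hxB, hxS⟩

theorem IsMeager.of_measurable [MeasurableSpace X] [BorelSpace X] (h : IsPerfectBase 𝒞)
    (hccc : CCC 𝒞) (hm : ∀ E, MeasurableSet E → IsMeager 𝒞 E → IsMeager 𝒟 E)
    (hS : IsMeager 𝒞 S) : IsMeager 𝒟 S :=
  let ⟨_, hT, hTm, hST⟩ := hS.exists_measurable_superset h hccc
  (hm _ hT hTm).mono hST

theorem IsBaire.of_measurable [T1Space X] [MeasurableSpace X] [BorelSpace X]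
    (h𝒞 : IsPerfectBase 𝒞) (hccc : CCC 𝒞) (h𝒟 : IsPerfectBase 𝒟)
    (hm : ∀ E, MeasurableSet E → IsMeager 𝒞 E → IsMeager 𝒟 E)
    (hS : IsBaire 𝒞 S) : IsBaire 𝒟 S :=
  let ⟨_, hF, h₁, h₂⟩ := hS.exists_measurable h𝒞 hccc
  (h𝒟.isBaire_of_measurableSet hF).of_diff (h₁.of_measurable h𝒞 hccc hm)
    (h₂.of_measurable h𝒞 hccc hm)

/-- Perfect c.c.c. bases with the same measurable meager sets are equivalent. -/
theorem equivalent_of_measurable [T1Space X] [MeasurableSpace X] [BorelSpace X]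
    (h𝒞 : IsPerfectBase 𝒞) (hc𝒞 : CCC 𝒞) (h𝒟 : IsPerfectBase 𝒟) (hc𝒟 : CCC 𝒟)
    (hm : ∀ E, MeasurableSet E → (IsMeager 𝒞 E ↔ IsMeager 𝒟 E)) : Equivalent 𝒞 𝒟 :=
  ⟨Set.ext fun _ => ⟨fun h => h.of_measurable h𝒞 hc𝒞 fun E hE => (hm E hE).1,
      fun h => h.of_measurable h𝒟 hc𝒟 fun E hE => (hm E hE).2⟩,
    Set.ext fun _ => ⟨fun h => h.of_measurable h𝒞 hc𝒞 h𝒟 fun E hE => (hm E hE).1,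
      fun h => h.of_measurable h𝒟 hc𝒟 h𝒞 fun E hE => (hm E hE).2⟩⟩

end Perfect

/-! ### Translation bases and orthogonality. -/

section Translation

variable {X : Type*} [AddCommGroup X] {𝒞 𝒟 : Set (Set X)} {S E A : Set X}

theorem IsMeager.image_add_right (h : TranslationInvariant 𝒞) (hS : IsMeager 𝒞 S) (r : X) :
    IsMeager 𝒞 ((fun x => x + r) '' S) :=
  hS.image_equiv (Equiv.addRight r) (fun A hA => h A hA r) fun A hA => by
    simpa [sub_eq_add_neg] using h A hA (-r)

theorem isMeager_biUnion_image_add_right (h : TranslationInvariant 𝒞) (hS : IsMeager 𝒞 S)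
    {D : Set X} (hD : D.Countable) : IsMeager 𝒞 (⋃ r ∈ D, (fun x => x + r) '' S) :=
  IsMeager.biUnion hD fun r _ => hS.image_add_right h r

variable [TopologicalSpace X]

/-- Otherwise the countable union of dense translates of `A` would be meager too, against its
abundance everywhere. -/
theorem IsTranslationBase.not_isMeager [TopologicalSpace.SeparableSpace X]
    (h : IsTranslationBase 𝒞) (hA : IsRegion 𝒞 A) : ¬ IsMeager 𝒞 A := by
  intro hm
  obtain ⟨D, hD, hDd⟩ := TopologicalSpace.exists_countable_dense X
  exact h.abundantEverywhere A hA D hD hDd A hA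
    ((isMeager_biUnion_image_add_right h.translationInvariant hm hD).mono inter_subset_right)

/-- A Borel set that is meager in one perfect translation base and abundant in another yields a
partition of the space into a meager set of the first and a meager set of the second. -/
theorem exists_isMeager_isMeager_compl [TopologicalSpace.SeparableSpace X] [T1Space X]
    [ContinuousAdd X] [MeasurableSpace X] [BorelSpace X]
    (h𝒞 : IsTranslationBase 𝒞) (h𝒟 : IsPerfectTranslationBase 𝒟)
    (hE : MeasurableSet E) (hEm : IsMeager 𝒞 E) (hEa : ¬ IsMeager 𝒟 E) :
    ∃ N, IsMeager 𝒞 N ∧ IsMeager 𝒟 Nᶜ := by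
  obtain ⟨D, hD, hDd⟩ := TopologicalSpace.exists_countable_dense X
  obtain ⟨B, hB, hBE⟩ := h𝒟.1.exists_isMeager_diff (h𝒟.1.isBaire_of_measurableSet hE) hEa
  refine ⟨_, isMeager_biUnion_image_add_right h𝒞.translationInvariant hEm hD, ?_⟩
  have hclosed : ∀ r : X, IsClosed ((fun x => x + r) '' B) := fun r =>
    (h𝒟.1.perfect _ (h𝒟.2.translationInvariant B hB.1 r)).closed
  -- This complement is Borel; were it abundant, it would contain a region `G` up to a meager set,
  -- and the translates of `B` would be meager in `G`.
  have hW : IsMeager 𝒟 (⋃ r ∈ D, (fun x => x + r) '' B)ᶜ := by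
    by_contra hab
    have hWm : MeasurableSet (⋃ r ∈ D, (fun x => x + r) '' B)ᶜ :=
      (MeasurableSet.biUnion hD fun r _ => (hclosed r).measurableSet).compl
    obtain ⟨G, hG, hGm⟩ := h𝒟.1.exists_isMeager_diff (h𝒟.1.isBaire_of_measurableSet hWm) hab
    rw [sdiff_compl] at hGm
    exact h𝒟.2.abundantEverywhere B hB D hD hDd G hG hGm
  refine (hW.union
    (isMeager_biUnion_image_add_right h𝒟.2.translationInvariant hBE hD)).mono fun x hx => ?_
  by_cases hx' : x ∈ ⋃ r ∈ D, (fun x => x + r) '' B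
  · obtain ⟨r, hr, y, hy, rfl⟩ := mem_iUnion₂.1 hx'
    exact Or.inr (mem_iUnion₂.2 ⟨r, hr, y, ⟨hy, fun hyE =>
      hx (mem_iUnion₂.2 ⟨r, hr, y, hyE, rfl⟩)⟩, rfl⟩)
  · exact Or.inl hx'

/-- Inequivalent perfect translation bases, one of which satisfies c.c.c., are orthogonal. -/
theorem exists_isMeager_isMeager_compl_of_not_equivalent [TopologicalSpace.SeparableSpace X]
    [T1Space X] [ContinuousAdd X] [MeasurableSpace X] [BorelSpace X]
    (h𝒞 : IsPerfectTranslationBase 𝒞) (hccc : CCC 𝒞) (h𝒟 : IsPerfectTranslationBase 𝒟)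
    (hne : ¬ Equivalent 𝒞 𝒟) : ∃ N, IsMeager 𝒞 N ∧ IsMeager 𝒟 Nᶜ := by
  by_contra hno
  have hm : ∀ E, MeasurableSet E → (IsMeager 𝒞 E ↔ IsMeager 𝒟 E) := by
    refine fun E hE => ⟨fun hEm => ?_, fun hEm => ?_⟩ <;> by_contra hEa
    · exact hno (exists_isMeager_isMeager_compl h𝒞.2 h𝒟 hE hEm hEa)
    · obtain ⟨N, h₁, h₂⟩ := exists_isMeager_isMeager_compl h𝒟.2 h𝒞 hE hEm hEa
      exact hno ⟨Nᶜ, h₂, by rwa [compl_compl]⟩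
  -- `𝒟` inherits c.c.c.: its regions are closed, hence `𝒞`-Baire, and `𝒞`-abundant because the
  -- Borel meager sets agree.
  refine hne (equivalent_of_measurable h𝒞.1 hccc h𝒟.1 (fun 𝓔 h𝓔 hd => ?_) hm)
  refine h𝒞.1.countable_of_pairwiseDisjoint h𝒞.1.nontrivial hccc (fun A hA => ?_) hd
  have hA' : IsClosed A := (h𝒟.1.perfect A (h𝓔 A hA).1).closed
  exact ⟨h𝒞.1.isBaire_of_isClosed hA',
    fun h => h𝒟.2.not_isMeager (h𝓔 A hA) ((hm A hA'.measurableSet).1 h)⟩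

end Translation

/-- A rare set is meager in every inequivalent perfect translation base. -/
theorem IsRare.isMeager_of_not_equivalent {X : Type*} [AddCommGroup X] [TopologicalSpace X]
    [TopologicalSpace.SeparableSpace X] [T1Space X] [ContinuousAdd X] {𝒞 𝒟 : Set (Set X)}
    {R : Set X} (hR : IsRare 𝒞 R) (h𝒞 : IsPerfectTranslationBase 𝒞) (hccc : CCC 𝒞)
    (h𝒟 : IsPerfectTranslationBase 𝒟) (hne : ¬ Equivalent 𝒞 𝒟) : IsMeager 𝒟 R := by
  borelize X
  obtain ⟨N, h₁, h₂⟩ := exists_isMeager_isMeager_compl_of_not_equivalent h𝒞 hccc h𝒟 hne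
  refine ((h𝒟.1.isMeager_of_countable (hR.2 N h₁)).union h₂).mono fun x hx => ?_
  by_cases hxN : x ∈ N
  exacts [Or.inl ⟨hx, hxN⟩, Or.inr hxN]

/-! ### Enumerating Borel sets under CH; perfect sets are uncountable. -/

section Construction

variable {X : Type*}

/-- Under the continuum hypothesis, the Borel sets of a second countable space have a well-order
with countable initial segments. -/
theorem exists_isWellOrder_countable [TopologicalSpace X] [SecondCountableTopology X]
    [MeasurableSpace X] [BorelSpace X] (hCH : (2 : Cardinal.{0}) ^ ℵ₀ = ℵ₁) :
    ∃ r : {s : Set X // MeasurableSet s} → {s : Set X // MeasurableSet s} → Prop,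
      IsWellOrder _ r ∧ ∀ a, {b | r b a}.Countable := by
  obtain ⟨r, hr, hcard⟩ := exists_isWellOrder_card_lt {s : Set X // MeasurableSet s}
  refine ⟨r, hr, fun a => ?_⟩
  have hle : #{s : Set X // MeasurableSet s} ≤ 𝔠 := by
    have := MeasurableSpace.cardinal_measurableSet_le_continuum
      (s := TopologicalSpace.countableBasis X)
      (((TopologicalSpace.countable_countableBasis X).le_aleph0).trans
        Cardinal.aleph0_le_continuum)
    rwa [← (TopologicalSpace.isBasis_countableBasis X).borel_eq_generateFrom,
      ← BorelSpace.measurable_eq (α := X)] at this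
  -- Lifts CH from universe 0 to the universe of `X`.
  have hc : Cardinal.continuum.{_} = ℵ₁ := by
    have := congrArg Cardinal.lift.{_, 0} hCH
    simpa using this
  rw [hc] at hle
  exact Cardinal.le_aleph0_iff_set_countable.1
    (Cardinal.lt_aleph_one_iff.1 ((hcard a).trans_le hle))

theorem not_countable_of_perfect [TopologicalSpace X] [PolishSpace X] {P : Set X}
    (hP : Perfect P) (hne : P.Nonempty) : ¬ P.Countable := by
  let := TopologicalSpace.upgradeIsCompletelyMetrizable X
  obtain ⟨f, hfP, -, hf⟩ := hP.exists_nat_bool_injection hne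
  intro hc
  have heq : #(ℕ → Bool) = 𝔠 := by simp
  have hu : Countable (ℕ → Bool) := by
    have := (hc.mono hfP).to_subtype
    exact (rangeFactorization_injective.2 hf).countable
  have hle : #(ℕ → Bool) ≤ ℵ₀ := Cardinal.mk_le_aleph0_iff.2 hu
  exact not_le.2 Cardinal.aleph0_lt_continuum (heq ▸ hle)

end Construction

/-! ### Reflections `x ↦ p - x`, obtained from scaling by `-1` and translating. -/

section Reflection

variable {X : Type*} [AddCommGroup X] [Module ℝ X] {𝒞 : Set (Set X)} {S : Set X}

theorem LinearlyInvariant.image_sub_mem (h : LinearlyInvariant 𝒞) (p : X) {A : Set X}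
    (hA : A ∈ 𝒞) : (fun x => p - x) '' A ∈ 𝒞 := by
  have := h.1 _ (h.2 A hA (-1) (by norm_num)) p
  rw [← image_smul, image_image] at this
  simpa [neg_add_eq_sub] using this

theorem IsMeager.image_sub_left (h : LinearlyInvariant 𝒞) (hS : IsMeager 𝒞 S) (p : X) :
    IsMeager 𝒞 ((fun x => p - x) '' S) :=
  hS.image_equiv (Equiv.subLeft p) (fun _ hA => h.image_sub_mem p hA) fun A hA => by
    simpa [neg_add_eq_sub] using h.image_sub_mem p hA

end Reflection

/-- A transfinite sequence that eventually leaves every measurable meager set has rare range. -/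
theorem isRare_range {X : Type*} [TopologicalSpace X] [T1Space X] [MeasurableSpace X]
    [BorelSpace X] {𝒞 : Set (Set X)} (h : IsPerfectBase 𝒞) (hccc : CCC 𝒞)
    {r : {s : Set X // MeasurableSet s} → {s : Set X // MeasurableSet s} → Prop}
    [IsWellOrder _ r] (hr : ∀ a, {b | r b a}.Countable) {f : {s : Set X // MeasurableSet s} → X}
    (hf : ∀ a b, r b a ∨ b = a → IsMeager 𝒞 b.1 → f a ∉ b.1) : IsRare 𝒞 (range f) := by
  refine ⟨fun hc => ?_, fun M hM => ?_⟩
  -- A countable range would itself be a meager Borel set, hence an index `a`, and `f a` would have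
  -- to avoid it.
  · let a : {s : Set X // MeasurableSet s} := ⟨range f, hc.measurableSet⟩
    exact hf a a (Or.inr rfl) (h.isMeager_of_countable hc) (mem_range_self a)
  · obtain ⟨T, hT, hTm, hMT⟩ := hM.exists_measurable_superset h hccc
    refine ((hr ⟨T, hT⟩).image f).mono ?_
    rintro _ ⟨⟨a, rfl⟩, ha⟩
    refine ⟨a, ?_, rfl⟩
    rcases trichotomous_of r a ⟨T, hT⟩ with h' | h' | h'
    · exact h'
    · exact absurd (hMT ha) (hf a ⟨T, hT⟩ (Or.inr h'.symm) hTm)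
    · exact absurd (hMT ha) (hf a ⟨T, hT⟩ (Or.inl h') hTm)

/-! ### The transfinite recursion. -/

section Step

variable {X : Type*} [AddCommGroup X] [Module ℝ X] [TopologicalSpace X] [PolishSpace X]

/-- A point of an uncountable set is a sum of two points outside a given meager set, and a second
point of it lies outside a given countable set. -/
theorem exists_add_mem {𝒞 : Set (Set X)} (hbase : IsPerfectTranslationBase 𝒞)
    (hlin : LinearlyInvariant 𝒞) {P Z M : Set X} (hP : ¬ P.Countable) (hZ : Z.Countable)
    (hM : IsMeager 𝒞 M) : ∃ x y, x ∉ M ∧ y ∉ M ∧ x + y ∈ P \ Z := by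
  obtain ⟨p, hp⟩ : (P \ Z).Nonempty := by
    rw [nonempty_iff_ne_empty, Ne, sdiff_eq_empty]
    exact fun h => hP (hZ.mono h)
  -- Avoiding the reflected set `p - M` is what keeps `p - x` out of `M`.
  obtain ⟨x, hx⟩ : ∃ x, x ∉ M ∪ (fun x => p - x) '' M := by
    by_contra! hall
    obtain ⟨x⟩ := hbase.1.nonempty
    obtain ⟨A, hA, -⟩ := hbase.1.cover x
    exact hbase.2.not_isMeager hA ((hM.union (hM.image_sub_left hlin p)).mono fun y _ => hall y)
  refine ⟨x, p - x, fun h => hx (Or.inl h), fun h => hx (Or.inr ⟨p - x, h, ?_⟩), ?_⟩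
  · exact sub_sub_cancel p x
  · rwa [add_sub_cancel]

theorem exists_rare_add_bernstein (hCH : (2 : Cardinal.{0}) ^ ℵ₀ = ℵ₁) {𝒞 : Set (Set X)}
    (hbase : IsPerfectTranslationBase 𝒞) (hccc : CCC 𝒞) (hlin : LinearlyInvariant 𝒞) :
    ∃ R₁ R₂ : Set X, IsRare 𝒞 R₁ ∧ IsRare 𝒞 R₂ ∧ IsBernstein (R₁ + R₂) := by
  borelize X
  obtain ⟨r, hr, hcount⟩ := exists_isWellOrder_countable (X := X) hCH
  have huniv : ¬ (univ : Set X).Countable := by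
    obtain ⟨x⟩ := hbase.1.nonempty
    obtain ⟨A, hA, -⟩ := hbase.1.cover x
    exact fun h => not_countable_of_perfect (hbase.1.perfect A hA.1) hA.2 (h.mono (subset_univ A))
  -- Each index plays two roles: a meager set to avoid from then on, and a perfect set to hit. The
  -- triple `w` holds a point of `R₁`, a point of `R₂` and a forbidden sum. The last two groups of
  -- conditions keep new sums off old forbidden points, and the new forbidden point off all sums
  -- formed so far.
  obtain ⟨f, hf⟩ := exists_wellFounded_choice (Y := X × X × X) hr.wf
    (fun a g w => (∀ b, r b a ∨ b = a → IsMeager 𝒞 b.1 → w.1 ∉ b.1 ∧ w.2.1 ∉ b.1) ∧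
      (Perfect a.1 → a.1.Nonempty → w.1 + w.2.1 ∈ a.1 ∧ w.2.2 ∈ a.1) ∧
      (∀ b hb, w.1 + w.2.1 ≠ (g b hb).2.2 ∧ ∀ c hc,
        w.1 + (g c hc).2.1 ≠ (g b hb).2.2 ∧ (g c hc).1 + w.2.1 ≠ (g b hb).2.2) ∧
      w.1 + w.2.1 ≠ w.2.2 ∧ ∀ b hb, w.1 + (g b hb).2.1 ≠ w.2.2 ∧ (g b hb).1 + w.2.1 ≠ w.2.2 ∧
        ∀ c hc, (g b hb).1 + (g c hc).2.1 ≠ w.2.2)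
    (fun a g => by
      obtain ⟨P, hP, hPa⟩ : ∃ P : Set X, ¬ P.Countable ∧
          (Perfect a.1 → a.1.Nonempty → P = a.1) := by
        by_cases ha : Perfect a.1 ∧ a.1.Nonempty
        · exact ⟨a.1, not_countable_of_perfect ha.1 ha.2, fun _ _ => rfl⟩
        · exact ⟨univ, huniv, fun h₁ h₂ => absurd ⟨h₁, h₂⟩ ha⟩
      have : Countable {b // r b a} := (hcount a).to_subtype
      let u : {b // r b a} → X := fun b => (g b.1 b.2).1
      let v : {b // r b a} → X := fun b => (g b.1 b.2).2.1
      let z : {b // r b a} → X := fun b => (g b.1 b.2).2.2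
      let I : Set {s : Set X // MeasurableSet s} := {b | (r b a ∨ b = a) ∧ IsMeager 𝒞 b.1}
      have hI : I.Countable := ((hcount a).union (countable_singleton a)).mono fun b hb => hb.1
      -- The countable sets of differences are the values of `x` or `y` whose sum with an earlier
      -- point is an earlier forbidden point.
      have hM : IsMeager 𝒞 ((⋃ b ∈ I, b.1) ∪
          (range (fun q : {b // r b a} × {b // r b a} => z q.1 - v q.2) ∪
            range (fun q : {b // r b a} × {b // r b a} => z q.1 - u q.2))) :=
        (IsMeager.biUnion hI fun b hb => hb.2).union
          (hbase.1.isMeager_of_countable ((countable_range _).union (countable_range _)))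
      obtain ⟨x, y, hx, hy, hxy, hz⟩ := exists_add_mem hbase hlin hP (countable_range z) hM
      obtain ⟨w, hwP, hw⟩ : (P \ ({x + y} ∪ (range (fun b => x + v b) ∪ (range (fun b => u b + y) ∪
          range (fun q : {b // r b a} × {b // r b a} => u q.1 + v q.2))))).Nonempty := by
        rw [nonempty_iff_ne_empty, Ne, sdiff_eq_empty]
        exact fun h => hP (((countable_singleton _).union ((countable_range _).union
          ((countable_range _).union (countable_range _)))).mono h)
      simp only [mem_union, not_or] at hx hy hw
      refine ⟨(x, y, w), fun b hb hbm => ⟨fun h => hx.1 (mem_iUnion₂.2 ⟨b, ⟨hb, hbm⟩, h⟩),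
        fun h => hy.1 (mem_iUnion₂.2 ⟨b, ⟨hb, hbm⟩, h⟩)⟩,
        fun h₁ h₂ => ⟨hPa h₁ h₂ ▸ hxy, hPa h₁ h₂ ▸ hwP⟩,
        fun b hb => ⟨fun h => hz ⟨⟨b, hb⟩, h.symm⟩, fun c hc => ⟨fun h => ?_, fun h => ?_⟩⟩,
        fun h => hw.1 h.symm, fun b hb => ⟨fun h => hw.2.1 ⟨⟨b, hb⟩, h⟩,
          fun h => hw.2.2.1 ⟨⟨b, hb⟩, h⟩, fun c hc h => hw.2.2.2 ⟨(⟨b, hb⟩, ⟨c, hc⟩), h⟩⟩⟩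
      · exact hx.2.1 ⟨(⟨b, hb⟩, ⟨c, hc⟩), (eq_sub_of_add_eq h).symm⟩
      · exact hy.2.2 ⟨(⟨b, hb⟩, ⟨c, hc⟩), (eq_sub_of_add_eq' h).symm⟩)
  -- The conditions imposed at the latest of the three stages exclude the equality.
  have havoid : ∀ a b c, (f a).1 + (f b).2.1 ≠ (f c).2.2 := by
    intro a b c
    rcases trichotomous_of r a b with hab | rfl | hab
    · rcases trichotomous_of r b c with hbc | rfl | hbc
      · exact ((hf c).2.2.2.2 a (trans_of r hab hbc)).2.2 b hbc
      · exact ((hf b).2.2.2.2 a hab).2.1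
      · exact (((hf b).2.2.1 c hbc).2 a hab).2
    · rcases trichotomous_of r a c with hac | rfl | hac
      · exact ((hf c).2.2.2.2 a hac).2.2 a hac
      · exact (hf a).2.2.2.1
      · exact ((hf a).2.2.1 c hac).1
    · rcases trichotomous_of r a c with hac | rfl | hac
      · exact ((hf c).2.2.2.2 a hac).2.2 b (trans_of r hab hac)
      · exact ((hf a).2.2.2.2 b hab).1
      · exact (((hf a).2.2.1 c hac).2 b hab).1
  refine ⟨range fun a => (f a).1, range fun a => (f a).2.1,
    isRare_range hbase.1 hccc hcount fun a b hb hm => ((hf a).1 b hb hm).1,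
    isRare_range hbase.1 hccc hcount fun a b hb hm => ((hf a).1 b hb hm).2, fun P hP hne => ?_⟩
  obtain ⟨h₁, h₂⟩ := (hf ⟨P, hP.closed.measurableSet⟩).2.1 hP hne
  refine ⟨⟨_, add_mem_add (mem_range_self _) (mem_range_self _), h₁⟩, ⟨_, ?_, h₂⟩⟩
  rintro ⟨_, ⟨a, rfl⟩, _, ⟨b, rfl⟩, hab⟩
  exact havoid a b _ hab

end Step

end CategoryBase

theorem theorem2p10 {X : Type*} [AddCommGroup X] [Module ℝ X] [TopologicalSpace X]
    [IsTopologicalAddGroup X] [ContinuousSMul ℝ X] [PolishSpace X]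
    (hCH : (2 : Cardinal.{0}) ^ ℵ₀ = ℵ₁)
    (𝒞 : Set (Set X)) (hbase : CategoryBase.IsPerfectTranslationBase 𝒞)
    (hccc : CategoryBase.CCC 𝒞) (hlin : CategoryBase.LinearlyInvariant 𝒞)
    (hcard : #𝒞 ≤ 2 ^ ℵ₀) :
    ∃ R₁ R₂ : Set X,
      CategoryBase.IsRare 𝒞 R₁ ∧ CategoryBase.IsRare 𝒞 R₂ ∧
      CategoryBase.IsBernstein (R₁ + R₂) ∧
      ∀ 𝒟 : Set (Set X), CategoryBase.IsPerfectTranslationBase 𝒟 →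
        ¬ CategoryBase.Equivalent 𝒞 𝒟 →
        CategoryBase.IsMeager 𝒟 R₁ ∧ CategoryBase.IsMeager 𝒟 R₂ := by
  obtain ⟨R₁, R₂, h₁, h₂, hB⟩ := CategoryBase.exists_rare_add_bernstein hCH hbase hccc hlin
  exact ⟨R₁, R₂, h₁, h₂, hB, fun 𝒟 h𝒟 hne =>
    ⟨h₁.isMeager_of_not_equivalent hbase hccc h𝒟 hne,
      h₂.isMeager_of_not_equivalent hbase hccc h𝒟 hne⟩⟩
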